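/- Let $n \ge 0$. An $n$-pod is a triple $\Pi = \big((p_1,\dots,p_n),(P_1,\dots,P_n),(d_1,\dots,d_n)\big)$ with platform points $p_i \in \mathbb{R}^3$, base points $P_i \in \mathbb{R}^3$ and leg lengths $d_i \in \mathbb{R}$. Let $\mathrm{SE}_{3,\mathbb{C}}$ be the complexification of the group of direct isometries of $\mathbb{R}^3$, that is, the affine variety of all $(M,x,y,r) \in \mathbb{C}^{3\times 3}\times\mathbb{C}^3\times\mathbb{C}^3\times\mathbb{C}$ with $MM^t=M^tM=\mathrm{id}$, $\det M=1$, $M^ty+x=0$, $Mx+y=0$ and $\langle x,x\rangle=\langle y,y\rangle=r$, where $\langle\cdot,\cdot\rangle$ is the bilinear extension of the Euclidean scalar product; the point $(M,x,y,r)$ stands for the map $v\mapsto Mv+y$. The mobility of $\Pi$ is the dimension, as a complex algebraic variety, of the set of all $(M,x,y,r) \in \mathrm{SE}_{3,\mathbb{C}}$ that satisfy the spherical condition $\langle Mp_i+y-P_i,\,Mp_i+y-P_i\rangle=d_i^2$, equivalently $$\langle p_i,p_i\rangle+\langle P_i,P_i\rangle+r-2\langle p_i,x\rangle-2\langle y,P_i\rangle-2\langle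 Mp_i,P_i\rangle=d_i^2,$$ for all $i=1,\dots,n$. For $\varepsilon\in S^2$ let $\pi_\varepsilon$ be the orthogonal projection of $\mathbb{R}^3$ along $\varepsilon$ onto the plane $\varepsilon^\perp$ through the origin. Points $q_1,\dots,q_n$ of a Euclidean plane $A$ and points $Q_1,\dots,Q_n$ of a Euclidean plane $B$ differ by a similarity if some similarity $A \to B$ maps $q_i$ to $Q_i$ for all $i$; they differ by an inversion if there is an inversion of $A$ in a circle whose centre is none of the $q_i$ which, followed by an isometry $A\to B$, maps $q_i$ to $Q_i$ for all $i$. **Theorem.** Let $\Pi$ be an $n$-pod with mobility $2$ or higher. Then at least one of the following holds: (a) there are infinitely many pairs $(L,R)\in S^2\times S^2$ such that the points $\pi_L(p_1),\dots,\pi_L(p_n)$ and $\pi_R(P_1),\dots,\pi_R(P_n)$ differ by an inversion or a similarity; (b) up to a permutation of the indices and an interchange of base and platform, there is an $m$ with $0 \le m\le n$ such that $p_1,\dots,p_m$ are collinear and $P_{m+1}=\dots=P_n$; (c) up to a permutation of the indices, there is an $m$ with $1<m<n-1$ such that $p_1,\dots,p_m$ lie on a line $g$ and $p_{m+1},\dots,p_n$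 lie on a line $g'\neq g$ parallel to $g$, and $P_1,\dots,P_m$ lie on a line $G$ and $P_{m+1},\dots,P_n$ lie on a line $G'\neq G$ parallel to $G$. -/

import Mathlib

open scoped Matrix

noncomputable section

/-- Euclidean three-space. -/
abbrev E3 : Type := EuclideanSpace ℝ (Fin 3)

/-- An `n`-pod: platform points `p i`, base points `P i` and leg lengths `d i`. -/
structure NPod (n : ℕ) where
  p : Fin n → E3
  P : Fin n → E3
  d : Fin n → ℝ

/-- The coordinates `M = (m i j)`, `x`, `y`, `r` of the affine chart `h = 1` of the projective
space of dimension 16 with homogeneous coordinates `(h : M : x : y : r)`. -/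
inductive Coord : Type
  | m (i j : Fin 3) : Coord
  | x (i : Fin 3) : Coord
  | y (i : Fin 3) : Coord
  | r : Coord

namespace Coord

/-- The matrix `M` of a point of the chart. -/
def matM (z : Coord → ℂ) : Matrix (Fin 3) (Fin 3) ℂ := Matrix.of fun i j => z (m i j)

/-- The vector `x` of a point of the chart. -/
def vecX (z : Coord → ℂ) : Fin 3 → ℂ := fun i => z (x i)

/-- The vector `y` of a point of the chart. -/
def vecY (z : Coord → ℂ) : Fin 3 → ℂ := fun i => z (y i)

end Coord

open Coord

/-- The complexification of the group of direct isometries `v ↦ M v + y` of three-space, where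
`x = -Mᵀ y` and `r = ⟨x, x⟩ = ⟨y, y⟩` (bilinear extension of the scalar product). -/
def complexSE3 : Set (Coord → ℂ) :=
  {z | matM z * (matM z)ᵀ = 1 ∧ (matM z)ᵀ * matM z = 1 ∧ (matM z).det = 1 ∧
    (matM z)ᵀ *ᵥ vecY z + vecX z = 0 ∧ matM z *ᵥ vecX z + vecY z = 0 ∧
    vecX z ⬝ᵥ vecX z = z r ∧ vecY z ⬝ᵥ vecY z = z r}

/-- A point of real three-space, viewed in complex three-space. -/
def complexify (q : E3) : Fin 3 → ℂ := fun k => (q k : ℂ)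

namespace NPod

variable {n : ℕ}

/-- The spherical condition of the `i`-th leg, written in the coordinates `(M, x, y, r)`, in
which it is linear. -/
def LegCondition (T : NPod n) (i : Fin n) (z : Coord → ℂ) : Prop :=
  complexify (T.p i) ⬝ᵥ complexify (T.p i) + complexify (T.P i) ⬝ᵥ complexify (T.P i) + z r
    - 2 * (complexify (T.p i) ⬝ᵥ vecX z) - 2 * (vecY z ⬝ᵥ complexify (T.P i))
    - 2 * ((matM z *ᵥ complexify (T.p i)) ⬝ᵥ complexify (T.P i)) = (T.d i : ℂ) ^ 2

/-- On the complexified group, the leg condition is the (complexified) spherical condition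
`⟨M p + y - P, M p + y - P⟩ = d ^ 2`. -/
theorem legCondition_iff_spherical (T : NPod n) (i : Fin n) {z : Coord → ℂ}
    (hz : z ∈ complexSE3) :
    T.LegCondition i z ↔
      (matM z *ᵥ complexify (T.p i) + vecY z - complexify (T.P i)) ⬝ᵥ
        (matM z *ᵥ complexify (T.p i) + vecY z - complexify (T.P i)) = (T.d i : ℂ) ^ 2 := by
  obtain ⟨-, h1, -, h2, -, -, h3⟩ := hz
  have e1 : (matM z *ᵥ complexify (T.p i)) ⬝ᵥ (matM z *ᵥ complexify (T.p i)) =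
      complexify (T.p i) ⬝ᵥ complexify (T.p i) := by
    rw [Matrix.dotProduct_mulVec, ← Matrix.mulVec_transpose, Matrix.mulVec_mulVec, h1,
      Matrix.one_mulVec]
  have e2 : (matM z *ᵥ complexify (T.p i)) ⬝ᵥ vecY z = -(complexify (T.p i) ⬝ᵥ vecX z) := by
    rw [dotProduct_comm, Matrix.dotProduct_mulVec, ← Matrix.mulVec_transpose,
      eq_neg_of_add_eq_zero_left h2, neg_dotProduct, dotProduct_comm]
  unfold LegCondition
  simp only [sub_dotProduct, dotProduct_sub, add_dotProduct, dotProduct_add, e1, e2, h3]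
  rw [dotProduct_comm (vecY z) (matM z *ᵥ complexify (T.p i)), e2,
    dotProduct_comm (complexify (T.P i)) (matM z *ᵥ complexify (T.p i)),
    dotProduct_comm (complexify (T.P i)) (vecY z)]
  constructor <;> intro h <;> rw [← h] <;> ring

/-- The part of the complex configuration set of the `n`-pod that lies in the complexified
group: all complexified direct isometries that satisfy the spherical condition of every leg. -/
def configurationSet (T : NPod n) : Set (Coord → ℂ) :=
  {z | z ∈ complexSE3 ∧ ∀ i, T.LegCondition i z}

/-- The mobility: the dimension of the configuration set as a complex algebraic variety, i.e. the
Krull dimension of its coordinate ring (it is `⊥` if the configuration set is empty). -/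
def mobility (T : NPod n) : WithBot ℕ∞ :=
  ringKrullDim (MvPolynomial Coord ℂ ⧸ MvPolynomial.vanishingIdeal ℂ T.configurationSet)

end NPod

/-- The plane through the origin orthogonal to `e`. -/
abbrev orthPlane (e : E3) : Submodule ℝ E3 := (Submodule.span ℝ {e})ᗮ

/-- The orthogonal projection along `e` onto the plane through the origin orthogonal to `e`. -/
def orthProj (e : E3) (q : E3) : orthPlane e := (orthPlane e).orthogonalProjectionOnto q

/-- Two families of points of Euclidean planes differ by a similarity of the planes. -/
def DifferBySimilarity {n : ℕ} {A B : Type*} [PseudoEMetricSpace A] [PseudoEMetricSpace B]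
    (q : Fin n → A) (Q : Fin n → B) : Prop :=
  ∃ κ : A ≃ᵈ B, ∀ i, κ (q i) = Q i

/-- Two families of points of Euclidean planes differ by an inversion: no point of the first family
is the centre `c` of the inversion in the circle of radius `ρ`, and this inversion, followed by an
isometry between the two planes, maps the first family to the second. -/
def DifferByInversion {n : ℕ} {A B : Type*} [NormedAddCommGroup A] [InnerProductSpace ℝ A]
    [NormedAddCommGroup B] [InnerProductSpace ℝ B] (q : Fin n → A) (Q : Fin n → B) : Prop :=
  ∃ (c : A) (ρ : ℝ) (ψ : A ≃ᵢ B), 0 < ρ ∧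
    ∀ i, q i ≠ c ∧ ψ (EuclideanGeometry.inversion c ρ (q i)) = Q i

/-- A line in three-space. -/
def IsLine (g : AffineSubspace ℝ E3) : Prop :=
  (g : Set E3).Nonempty ∧ Module.finrank ℝ g.direction = 1

end

noncomputable section

/-! The configuration variety is studied at infinity. An affine variety with only finitely many
points at infinity has dimension at most 1 (`ringKrullDim_quotient_le_one_of_finite`), so it is
enough to bound these points when (a), (b) and (c) all fail.

The top-degree parts of the equations force `M = c₀ w vᵗ`, `x = c₁ v`, `y = c₂ w`, `r = c₃` with
`v`, `w` isotropic (`NPod.IsBond.exists_coefficients`). Up to scale, an isotropic vector is a unit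
vector together with an orientation of its orthogonal plane, and its product with a real point is
the complex coordinate of the projection of that point. The leg lengths drop out, and leg `i`
becomes `c₃ - 2c₁ζ - 2c₂ω - 2c₀ζω = 0`, where `ζ`, `ω` are the coordinates of the projections of `p
i`, `P i`.

If this relation is nondegenerate it is a Möbius map: an inversion for `c₀ ≠ 0`, a similarity for
`c₀ = 0`. So failure of (a) leaves finitely many such pairs of axes; the degenerate pairs are
finitely many unless (b) holds (`finite_butterflyAxes`). Over a single pair of axes, two independent
relations split the legs as in (b) or (c) (`split_of_not_proportional`); otherwise the pair carries
at most one point at infinity. -/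

/-- The Krull dimension does not increase along an integral extension. -/
theorem ringKrullDim_le_of_isIntegral (R S : Type*) [CommRing R] [CommRing S] [Algebra R S]
    [Algebra.IsIntegral R S] : ringKrullDim S ≤ ringKrullDim R := by
  refine Order.krullDim_le_of_strictMono (PrimeSpectrum.comap (algebraMap R S)) fun p q hpq => ?_
  exact Ideal.IsIntegral.comap_lt_comap (R := R) (I := p.asIdeal) (J := q.asIdeal) hpq

/-! ### Bounding the dimension by the points at infinity. -/

section PointsAtInfinity

open MvPolynomial

variable {σ k : Type*} [Field k]

/-- The points at infinity of the zero locus of an ideal, as an affine cone: all points at which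
the top degree forms of the members of the ideal vanish. -/
def pointsAtInfinity (I : Ideal (MvPolynomial σ k)) : Set (σ → k) :=
  {z | ∀ f ∈ I, ∀ d, f.totalDegree ≤ d → eval z (homogeneousComponent d f) = 0}

/-- The polynomials of degree less than `e`. -/
def degreeBelow (σ k : Type*) [Field k] (e : ℕ) : Submodule k (MvPolynomial σ k) :=
  restrictSupport k {m | m.degree < e}

theorem monomial_mem_degreeBelow {e : ℕ} {m : σ →₀ ℕ} (hm : m.degree < e) (a : k) :
    monomial m a ∈ degreeBelow σ k e :=
  (monomial_mem_restrictSupport k).2 (Or.inl hm)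

theorem mem_degreeBelow {e : ℕ} {f : MvPolynomial σ k} :
    f ∈ degreeBelow σ k e ↔ ∀ m, coeff m f ≠ 0 → m.degree < e := by
  rw [degreeBelow, mem_restrictSupport_iff]
  constructor
  · intro h m hm
    exact h (mem_support_iff.2 hm)
  · intro h m hm
    exact h m (mem_support_iff.1 hm)

theorem monomial_mul_mem_degreeBelow {e : ℕ} {f : MvPolynomial σ k} (hf : f ∈ degreeBelow σ k e)
    (m : σ →₀ ℕ) (a : k) : monomial m a * f ∈ degreeBelow σ k (m.degree + e) := by
  classical
  rw [mem_degreeBelow] at hf ⊢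
  intro m' hm'
  rw [coeff_monomial_mul'] at hm'
  split_ifs at hm' with hle
  · have h := hf _ (right_ne_zero_of_mul hm')
    obtain ⟨c, rfl⟩ := exists_add_of_le hle
    rw [add_tsub_cancel_left] at h
    rw [map_add]
    omega
  · exact absurd rfl hm'

/-- The polynomials that are, up to degree less than `e`, congruent modulo the ideal `I` to a
multiple of `l` of degree at most `e`. -/
def reducibleMod (I : Ideal (MvPolynomial σ k)) (l : MvPolynomial σ k) (e : ℕ) :
    Submodule k (MvPolynomial σ k) :=
  I.restrictScalars k ⊔ (degreeBelow σ k e).map (LinearMap.mulLeft k l) ⊔ degreeBelow σ k e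

theorem mem_reducibleMod {I : Ideal (MvPolynomial σ k)} {l : MvPolynomial σ k} {e : ℕ}
    {f : MvPolynomial σ k} : f ∈ reducibleMod I l e ↔ ∃ i ∈ I, ∃ g ∈ degreeBelow σ k e,
      ∃ h ∈ degreeBelow σ k e, i + l * g + h = f := by
  simp [reducibleMod, Submodule.mem_sup]

theorem homogeneousComponent_monomial_mul (m : σ →₀ ℕ) (a : k) (f : MvPolynomial σ k) (e : ℕ) :
    homogeneousComponent e (monomial m a * f) =
      if m.degree ≤ e then monomial m a * homogeneousComponent (e - m.degree) f else 0 := by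
  classical
  ext m'
  rw [coeff_homogeneousComponent, coeff_monomial_mul', apply_ite (coeff m'), coeff_zero,
    coeff_monomial_mul', coeff_homogeneousComponent]
  by_cases hle : m ≤ m'
  · obtain ⟨c, rfl⟩ := exists_add_of_le hle
    simp only [map_add, add_tsub_cancel_left, hle, if_true]
    by_cases h : m.degree ≤ e
    · have : m.degree + c.degree = e ↔ c.degree = e - m.degree := by omega
      simp only [h, if_true, this, mul_ite, mul_zero]
    · have : m.degree + c.degree ≠ e := by omega
      simp [h, this]
  · simp [hle]

/-- The ideal of all polynomials whose homogeneous components are reducibleMod. -/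
def reducibleIdeal (I : Ideal (MvPolynomial σ k)) (l : MvPolynomial σ k) :
    Ideal (MvPolynomial σ k) where
  carrier := {g | ∀ e, homogeneousComponent e g ∈ reducibleMod I l e}
  add_mem' := fun {a b} ha hb e => by rw [map_add]; exact add_mem (ha e) (hb e)
  zero_mem' := fun e => by rw [map_zero]; exact zero_mem _
  smul_mem' := by
    intro c x hx
    rw [smul_eq_mul]
    -- Multiplication by a monomial only shifts the grading, so the components can be treated one at
    -- a time.
    induction c using MvPolynomial.induction_on' with
    | monomial m a =>
      intro e
      rw [homogeneousComponent_monomial_mul]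
      split_ifs with h
      · obtain ⟨i, hi, g, hg, r, hr, he⟩ := mem_reducibleMod.1 (hx (e - m.degree))
        rw [← he]
        have h1 := monomial_mul_mem_degreeBelow hg m a
        have h2 := monomial_mul_mem_degreeBelow hr m a
        rw [Nat.add_sub_cancel' h] at h1 h2
        exact mem_reducibleMod.2 ⟨_, I.mul_mem_left (monomial m a) hi, _, h1, _, h2, by ring⟩
      · exact zero_mem _
    | add p q hp hq =>
      intro e
      rw [add_mul, map_add]
      exact add_mem (hp e) (hq e)

/-- A top form differs from the polynomial itself, which is in `I`, by terms of lower degree. Hence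
the zeros of `reducibleIdeal I l` are points at infinity. -/
theorem homogeneousComponent_mem_reducibleIdeal {I : Ideal (MvPolynomial σ k)}
    (l : MvPolynomial σ k) {f : MvPolynomial σ k} (hf : f ∈ I) {d : ℕ} (hd : f.totalDegree ≤ d) :
    homogeneousComponent d f ∈ reducibleIdeal I l := by
  intro e
  rw [homogeneousComponent_of_mem (homogeneousComponent_mem d f)]
  split_ifs with h
  · subst h
    refine mem_reducibleMod.2 ⟨f, hf, 0, zero_mem _, homogeneousComponent e f - f, ?_, by ring⟩
    rw [mem_degreeBelow]
    intro m hm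
    rw [coeff_sub, coeff_homogeneousComponent] at hm
    split_ifs at hm with h1
    · simp at hm
    · rw [zero_sub, neg_ne_zero] at hm
      have := (le_totalDegree (mem_support_iff.2 hm)).trans hd
      have h2 : m.degree ≤ e := this
      omega
  · exact zero_mem _

theorem linear_mem_reducibleIdeal (I : Ideal (MvPolynomial σ k))
    {l : MvPolynomial σ k} (hl : l.IsHomogeneous 1) : l ∈ reducibleIdeal I l := by
  intro e
  rw [homogeneousComponent_of_mem hl]
  split_ifs with h
  · subst h
    refine mem_reducibleMod.2 ⟨0, zero_mem _, 1, ?_, 0, zero_mem _, by ring⟩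
    exact monomial_mem_degreeBelow (by simp) 1
  · exact zero_mem _

/-- By hypothesis the top forms of `I` and `l` have no common zero except the origin, so the
Nullstellensatz puts a power of every variable into the ideal. -/
theorem exists_monomial_mem_reducibleIdeal [IsAlgClosed k] [Finite σ]
    {I : Ideal (MvPolynomial σ k)} {l : MvPolynomial σ k} (hl : l.IsHomogeneous 1)
    (hI : ∀ z ∈ pointsAtInfinity I, eval z l = 0 → z = 0) :
    ∃ D, ∀ m : σ →₀ ℕ, D ≤ m.degree → monomial m (1 : k) ∈ reducibleIdeal I l := by
  have := Fintype.ofFinite σ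
  have hX : ∀ i : σ, ∃ N, (X i : MvPolynomial σ k) ^ N ∈ reducibleIdeal I l := by
    intro i
    have : X i ∈ vanishingIdeal k (zeroLocus k (reducibleIdeal I l)) := by
      rw [mem_vanishingIdeal_iff]
      intro z hz
      rw [mem_zeroLocus_iff] at hz
      have : z = 0 := by
        apply hI
        · intro f hf d hd
          exact hz _ (homogeneousComponent_mem_reducibleIdeal l hf hd)
        · exact hz _ (linear_mem_reducibleIdeal I hl)
      simp [this]
    rw [vanishingIdeal_zeroLocus_eq_radical] at this
    exact this
  choose N hN using hX
  -- Pigeonhole: in this degree some exponent reaches `N i`. The `+ 1` also covers an empty `σ`.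
  refine ⟨∑ i, N i + 1, fun m hm => ?_⟩
  have : ∃ i, N i ≤ m i := by
    by_contra! h
    have h1 : m.degree = ∑ i, m i := Finsupp.degree_eq_sum m
    have h2 : ∑ i, m i ≤ ∑ i, N i := Finset.sum_le_sum fun i _ => (h i).le
    omega
  obtain ⟨i, hi⟩ := this
  have h1 : monomial m (1 : k) = monomial (m - Finsupp.single i (N i)) 1 * X i ^ N i := by
    rw [X_pow_eq_monomial, monomial_mul, one_mul, tsub_add_cancel_of_le]
    simpa using hi
  rw [h1]
  exact Ideal.mul_mem_left _ _ (hN i)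

/-- Noether normalization with the single parameter `l`: the quotient is generated over `k[l]` by
the monomials of degree below `D`, so it is integral over a ring of dimension 1. -/
theorem ringKrullDim_quotient_le_one [IsAlgClosed k] [Finite σ]
    {I : Ideal (MvPolynomial σ k)} {l : MvPolynomial σ k} (hl : l.IsHomogeneous 1)
    (hI : ∀ z ∈ pointsAtInfinity I, eval z l = 0 → z = 0) :
    ringKrullDim (MvPolynomial σ k ⧸ I) ≤ 1 := by
  obtain ⟨D, hD⟩ := exists_monomial_mem_reducibleIdeal hl hI
  let φ : Polynomial k →ₐ[k] (MvPolynomial σ k ⧸ I) :=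
    Polynomial.aeval (Ideal.Quotient.mk I l)
  let _ : Algebra (Polynomial k) (MvPolynomial σ k ⧸ I) := φ.toRingHom.toAlgebra
  have hsmul : ∀ (f : MvPolynomial σ k),
      Ideal.Quotient.mk I (l * f) = (Polynomial.X : Polynomial k) • Ideal.Quotient.mk I f := by
    intro f
    rw [Algebra.smul_def, map_mul]
    congr 1
    exact (Polynomial.aeval_X (Ideal.Quotient.mk I l)).symm
  have hsmulC : ∀ (a : k) (f : MvPolynomial σ k),
      Ideal.Quotient.mk I (C a * f) = (Polynomial.C a) • Ideal.Quotient.mk I f := by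
    intro a f
    rw [Algebra.smul_def, map_mul]
    congr 1
    exact (Polynomial.aeval_C (Ideal.Quotient.mk I l) a).symm
  let B : Set (MvPolynomial σ k ⧸ I) :=
    (fun m : σ →₀ ℕ => Ideal.Quotient.mk I (monomial m 1)) '' {m | m.degree < D}
  have hB : B.Finite := by
    refine Set.Finite.image _ ?_
    have := Fintype.ofFinite σ
    refine (Finsupp.finite_of_degree_le (σ := σ) D).subset fun m hm => ?_
    exact (show m.degree < D from hm).le
  have key : ∀ e, ∀ f ∈ degreeBelow σ k e,
      Ideal.Quotient.mk I f ∈ Submodule.span (Polynomial k) B := by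
    intro e
    induction e with
    | zero =>
      intro f hf
      have : f = 0 := by
        ext m
        by_contra h
        exact absurd (mem_degreeBelow.1 hf m h) (by omega)
      rw [this, map_zero]
      exact zero_mem _
    | succ e ih =>
      intro f hf
      rw [f.as_sum, map_sum]
      refine sum_mem fun m hm => ?_
      have hm' := mem_degreeBelow.1 hf m (mem_support_iff.1 hm)
      rw [← mul_one (coeff m f), ← C_mul_monomial, hsmulC]
      refine Submodule.smul_mem _ _ ?_
      -- A monomial of degree at least `D` is, modulo `I`, of the form `l * g + r` with `g` and `r`
      -- of smaller degree; the induction applies to both.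
      by_cases hmD : m.degree < D
      · exact Submodule.subset_span ⟨m, hmD, rfl⟩
      · have h1 := hD m (not_lt.1 hmD) m.degree
        rw [homogeneousComponent_of_mem (isHomogeneous_monomial _ rfl), if_pos rfl] at h1
        obtain ⟨i, hi, g, hg, r, hr, he⟩ := mem_reducibleMod.1 h1
        have hmono : degreeBelow σ k m.degree ≤ degreeBelow σ k e :=
          restrictSupport_mono _ fun m' (h : m'.degree < m.degree) =>
            show m'.degree < e by omega
        rw [← he, map_add, map_add, hsmul, Ideal.Quotient.eq_zero_iff_mem.2 hi, zero_add]
        exact add_mem (Submodule.smul_mem _ _ (ih g (hmono hg))) (ih r (hmono hr))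
  have hfin : Module.Finite (Polynomial k) (MvPolynomial σ k ⧸ I) := by
    refine ⟨⟨hB.toFinset, ?_⟩⟩
    rw [Set.Finite.coe_toFinset, eq_top_iff]
    rintro x -
    obtain ⟨f, rfl⟩ := Ideal.Quotient.mk_surjective x
    refine key (f.totalDegree + 1) f (mem_degreeBelow.2 fun m hm => ?_)
    exact Nat.lt_succ_of_le (le_totalDegree (mem_support_iff.2 hm))
  have hint : Algebra.IsIntegral (Polynomial k) (MvPolynomial σ k ⧸ I) := inferInstance
  refine (ringKrullDim_le_of_isIntegral (Polynomial k) _).trans ?_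
  exact (IsPrincipalIdealRing.ringKrullDim_eq_one (Polynomial k) (Polynomial.not_isField k)).le

/-- If the points at infinity lie on finitely many lines through the origin, the dimension is at
most one. -/
theorem ringKrullDim_quotient_le_one_of_finite [IsAlgClosed k] [Finite σ]
    {I : Ideal (MvPolynomial σ k)} {ι : Type*} [Finite ι] (u : ι → σ → k) (hu : ∀ i, u i ≠ 0)
    (hI : ∀ z ∈ pointsAtInfinity I, z ≠ 0 → ∃ i, ∃ t : k, z = t • u i) :
    ringKrullDim (MvPolynomial σ k ⧸ I) ≤ 1 := by
  classical
  have := Fintype.ofFinite σ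
  -- Over an infinite field some hyperplane through the origin avoids finitely many nonzero vectors.
  obtain ⟨ℓ, hℓ⟩ := Module.exists_dual_forall_apply_ne_zero (K := k) u hu
  have hev : ∀ z, eval z (∑ s, C (ℓ (Pi.single s 1)) * X s : MvPolynomial σ k) = ℓ z := by
    intro z
    conv_rhs => rw [← Finset.univ_sum_single z, map_sum]
    rw [map_sum]
    refine Finset.sum_congr rfl fun s _ => ?_
    have : Pi.single s (z s) = z s • (Pi.single s 1 : σ → k) := by simp [← Pi.single_smul]
    rw [this, map_smul]
    simp [mul_comm]
  refine ringKrullDim_quotient_le_one (l := ∑ s, C (ℓ (Pi.single s 1)) * X s)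
    (IsHomogeneous.sum _ _ _ fun s _ => isHomogeneous_C_mul_X _ s) fun z hz h0 => ?_
  by_contra hz0
  obtain ⟨i, t, rfl⟩ := hI z hz hz0
  rw [hev, map_smul, smul_eq_mul] at h0
  rcases mul_eq_zero.1 h0 with h | h
  · exact hz0 (by rw [h, zero_smul])
  · exact hℓ i h

end PointsAtInfinity

open Coord

/-! ### The equations of the configuration set at infinity. -/

section ConfigurationAtInfinity

open MvPolynomial

/-- Here `q + r` is an equation of `S` with leading part `q`; only `q` survives at infinity. -/
theorem eval_top_form_eq_zero {σ k : Type*} [Field k] {S : Set (σ → k)} {z : σ → k}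
    (hz : z ∈ pointsAtInfinity (vanishingIdeal k S)) {q r : MvPolynomial σ k} {d : ℕ}
    (hq : q.IsHomogeneous d) (hr : r.totalDegree < d)
    (h : ∀ x ∈ S, eval x q + eval x r = 0) : eval z q = 0 := by
  have hmem : q + r ∈ vanishingIdeal k S := by
    rw [mem_vanishingIdeal_iff]
    intro x hx
    have := h x hx
    rwa [← map_add] at this
  have hdeg : (q + r).totalDegree ≤ d :=
    (totalDegree_add q r).trans (max_le hq.totalDegree_le hr.le)
  have := hz _ hmem d hdeg
  rwa [map_add, homogeneousComponent_eq_self hq, homogeneousComponent_eq_zero _ _ hr,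
    add_zero] at this

/-- The equations satisfied by the points at infinity of the configuration set. -/
structure NPod.IsBond {n : ℕ} (T : NPod n) (z : Coord → ℂ) : Prop where
  mul_transpose : matM z * (matM z)ᵀ = 0
  transpose_mul : (matM z)ᵀ * matM z = 0
  transpose_mulVec : (matM z)ᵀ *ᵥ vecY z = 0
  mulVec : matM z *ᵥ vecX z = 0
  xx : vecX z ⬝ᵥ vecX z = 0
  yy : vecY z ⬝ᵥ vecY z = 0
  leg : ∀ i, z r - 2 * (complexify (T.p i) ⬝ᵥ vecX z) - 2 * (vecY z ⬝ᵥ complexify (T.P i))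
    - 2 * ((matM z *ᵥ complexify (T.p i)) ⬝ᵥ complexify (T.P i)) = 0

theorem isHomogeneous_sum_X_mul_X {σ k : Type*} [Field k] (f g : Fin 3 → σ) :
    (∑ a, X (f a) * X (g a) : MvPolynomial σ k).IsHomogeneous 2 :=
  IsHomogeneous.sum _ _ _ fun a _ => (isHomogeneous_X k (f a)).mul (isHomogeneous_X k (g a))

theorem NPod.isBond_of_mem_pointsAtInfinity {n : ℕ} (T : NPod n) {z : Coord → ℂ}
    (hz : z ∈ pointsAtInfinity (vanishingIdeal ℂ T.configurationSet)) : T.IsBond z where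
  mul_transpose := by
    ext i j
    have := eval_top_form_eq_zero hz (isHomogeneous_sum_X_mul_X (fun a => m i a) fun a => m j a)
      (r := -C (if i = j then 1 else 0)) 
      (by rw [totalDegree_neg, totalDegree_C]; norm_num) fun x hx => by
        have := congr_fun (congr_fun hx.1.1 i) j
        simp only [Matrix.mul_apply, Matrix.transpose_apply, matM, Matrix.of_apply,
          Matrix.one_apply] at this
        simp [this]
    simpa [Matrix.mul_apply, matM] using this
  transpose_mul := by
    ext i j
    have := eval_top_form_eq_zero hz (isHomogeneous_sum_X_mul_X (fun a => m a i) fun a => m a j)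
      (r := -C (if i = j then 1 else 0)) 
      (by rw [totalDegree_neg, totalDegree_C]; norm_num) fun x hx => by
        have := congr_fun (congr_fun hx.1.2.1 i) j
        simp only [Matrix.mul_apply, Matrix.transpose_apply, matM, Matrix.of_apply,
          Matrix.one_apply] at this
        simp [this]
    simpa [Matrix.mul_apply, matM] using this
  transpose_mulVec := by
    ext i
    have := eval_top_form_eq_zero hz (isHomogeneous_sum_X_mul_X (fun a => m a i) fun a => y a)
      (r := X (x i)) (by simp) fun x hx => by
        have := congr_fun hx.1.2.2.2.1 i
        simpa [Matrix.mulVec, dotProduct, matM, vecX, vecY] using this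
    simpa [Matrix.mulVec, dotProduct, matM, vecY] using this
  mulVec := by
    ext i
    have := eval_top_form_eq_zero hz (isHomogeneous_sum_X_mul_X (fun a => m i a) fun a => x a)
      (r := X (y i)) (by simp) fun x hx => by
        have := congr_fun hx.1.2.2.2.2.1 i
        simpa [Matrix.mulVec, dotProduct, matM, vecX, vecY] using this
    simpa [Matrix.mulVec, dotProduct, matM, vecX] using this
  xx := by
    have := eval_top_form_eq_zero hz (isHomogeneous_sum_X_mul_X (fun a => x a) fun a => x a)
      (r := -X r) (by simp) fun x hx => by
        have := hx.1.2.2.2.2.2.1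
        simp only [dotProduct, vecX] at this
        simp [this]
    simpa [dotProduct, vecX] using this
  yy := by
    have := eval_top_form_eq_zero hz (isHomogeneous_sum_X_mul_X (fun a => y a) fun a => y a)
      (r := -X r) (by simp) fun x hx => by
        have := hx.1.2.2.2.2.2.2
        simp only [dotProduct, vecY] at this
        simp [this]
    simpa [dotProduct, vecY] using this
  leg := by
    intro i
    let p := complexify (T.p i)
    let P := complexify (T.P i)
    have hq : (X r + ∑ a, C (-2 * p a) * X (x a) + ∑ a, C (-2 * P a) * X (y a)
        + ∑ a, ∑ b, C (-2 * (P a * p b)) * X (m a b) :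
        MvPolynomial Coord ℂ).IsHomogeneous 1 := by
      refine (((isHomogeneous_X _ _).add ?_).add ?_).add ?_
      · exact IsHomogeneous.sum _ _ _ fun a _ => isHomogeneous_C_mul_X _ _
      · exact IsHomogeneous.sum _ _ _ fun a _ => isHomogeneous_C_mul_X _ _
      · exact IsHomogeneous.sum _ _ _ fun a _ => IsHomogeneous.sum _ _ _ fun b _ =>
          isHomogeneous_C_mul_X _ _
    have := eval_top_form_eq_zero hz hq
      (r := C (p ⬝ᵥ p + P ⬝ᵥ P - (T.d i : ℂ) ^ 2))
      (by rw [totalDegree_C]; norm_num) fun x hx => by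
        have := hx.2 i
        simp only [NPod.LegCondition, Matrix.mulVec, dotProduct, vecX, vecY, matM, Matrix.of_apply,
          Fin.sum_univ_three] at this
        simp only [map_add, map_mul, eval_X, eval_C, dotProduct, Fin.sum_univ_three, p, P]
        linear_combination this
    simp only [map_add, map_mul, eval_X, eval_C, Fin.sum_univ_three, p, P] at this
    simp only [Matrix.mulVec, dotProduct, vecX, vecY, matM, Matrix.of_apply, Fin.sum_univ_three]
    linear_combination this

end ConfigurationAtInfinity

/-! ### Isotropic complex vectors and oriented axes. -/

section IsotropicVectors

theorem complexify_dotProduct_complexify (a b : E3) :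
    complexify a ⬝ᵥ complexify b = ((inner ℝ a b : ℝ) : ℂ) := by
  simp only [dotProduct, complexify, PiLp.inner_apply, Fin.sum_univ_three]
  simp [mul_comm]

/-- Expansion of a complex vector in a real orthonormal basis. -/
theorem sum_dotProduct_smul_complexify (e : OrthonormalBasis (Fin 3) ℝ E3) (v : Fin 3 → ℂ) :
    ∑ j, (v ⬝ᵥ complexify (e j)) • complexify (e j) = v := by
  let O : Matrix (Fin 3) (Fin 3) ℂ := Matrix.of fun j k => complexify (e j) k
  have h : O * Oᵀ = 1 := by
    ext i j
    have := complexify_dotProduct_complexify (e i) (e j)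
    rw [e.inner_eq_ite] at this
    rw [Matrix.one_apply, Matrix.mul_apply]
    simp only [dotProduct] at this
    simp only [O, Matrix.transpose_apply, Matrix.of_apply, this]
    split_ifs <;> simp
  have h2 : Oᵀ * O = 1 := mul_eq_one_comm.1 h
  have h3 : Oᵀ *ᵥ (O *ᵥ v) = v := by rw [Matrix.mulVec_mulVec, h2, Matrix.one_mulVec]
  conv_rhs => rw [← h3]
  ext k
  simp only [Finset.sum_apply, Pi.smul_apply, smul_eq_mul, Matrix.mulVec, dotProduct,
    Matrix.transpose_apply, O, Matrix.of_apply]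
  refine Finset.sum_congr rfl fun j _ => ?_
  rw [mul_comm]
  congr 1
  exact Finset.sum_congr rfl fun k _ => mul_comm _ _

theorem sum_dotProduct_mul_dotProduct (e : OrthonormalBasis (Fin 3) ℝ E3) (v w : Fin 3 → ℂ) :
    ∑ j, (v ⬝ᵥ complexify (e j)) * (w ⬝ᵥ complexify (e j)) = v ⬝ᵥ w := by
  conv_rhs => rw [← sum_dotProduct_smul_complexify e w]
  rw [dotProduct_sum]
  refine Finset.sum_congr rfl fun j _ => ?_
  rw [dotProduct_smul, smul_eq_mul, mul_comm]

/-- A unit vector of Euclidean three-space with an orientation of the orthogonal plane. -/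
abbrev OrientedAxis : Type := Metric.sphere (0 : E3) 1 × Bool

theorem exists_orthonormalBasis_two_eq (L : Metric.sphere (0 : E3) 1) :
    ∃ e : OrthonormalBasis (Fin 3) ℝ E3, e 2 = L := by
  have hL : ‖(L : E3)‖ = 1 := by simp
  have : Orthonormal ℝ (Set.domRestrict ({2} : Set (Fin 3)) fun _ => (L : E3)) := by
    constructor
    · intro i
      simp
    · intro i j hij
      exact absurd (Subsingleton.elim i j) hij
  obtain ⟨b, hb⟩ := this.exists_orthonormalBasis_extension_of_card_eq (by simp)
  exact ⟨b, hb 2 rfl⟩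

/-- An orthonormal frame whose last vector is the given unit vector. -/
def axisFrame (f : OrientedAxis) : OrthonormalBasis (Fin 3) ℝ E3 :=
  if f.2 then (exists_orthonormalBasis_two_eq f.1).choose
  else (exists_orthonormalBasis_two_eq f.1).choose.reindex (Equiv.swap 0 1)

theorem axisFrame_two (f : OrientedAxis) : axisFrame f 2 = f.1 := by
  unfold axisFrame
  split_ifs
  · exact (exists_orthonormalBasis_two_eq f.1).choose_spec
  · rw [OrthonormalBasis.reindex_apply]
    exact (exists_orthonormalBasis_two_eq f.1).choose_spec

/-- The isotropic vector of an oriented axis. -/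
def axisVec (f : OrientedAxis) : Fin 3 → ℂ :=
  complexify (axisFrame f 0) + Complex.I • complexify (axisFrame f 1)

/-- The complex coordinate of the orthogonal projection along an axis. -/
def axisCoord (f : OrientedAxis) (q : E3) : ℂ :=
  (inner ℝ (axisFrame f 0) q : ℝ) + (inner ℝ (axisFrame f 1) q : ℝ) * Complex.I

theorem complexify_dotProduct_axisVec (f : OrientedAxis) (q : E3) :
    complexify q ⬝ᵥ axisVec f = axisCoord f q := by
  rw [axisVec, axisCoord, dotProduct_add, dotProduct_smul, complexify_dotProduct_complexify,
    complexify_dotProduct_complexify, smul_eq_mul, real_inner_comm (axisFrame f 0),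
    real_inner_comm (axisFrame f 1), mul_comm]

theorem dotProduct_axisVec (f : OrientedAxis) (v : Fin 3 → ℂ) :
    v ⬝ᵥ axisVec f = v ⬝ᵥ complexify (axisFrame f 0)
      + Complex.I * (v ⬝ᵥ complexify (axisFrame f 1)) := by
  rw [axisVec, dotProduct_add, dotProduct_smul, smul_eq_mul]

theorem axisVec_ne_zero (f : OrientedAxis) : axisVec f ≠ 0 := by
  intro h
  have := complexify_dotProduct_axisVec f (axisFrame f 0)
  rw [h, dotProduct_zero, axisCoord, OrthonormalBasis.inner_eq_ite,
    OrthonormalBasis.inner_eq_ite] at this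
  simp at this

/-- In frame coordinates `A`, `B`, `C` the first condition is `A + iB = 0`. Then `A² + B² = 0`, and
isotropy forces `C = 0`. -/
theorem eq_smul_axisVec {f : OrientedAxis} {v : Fin 3 → ℂ} (h1 : v ⬝ᵥ axisVec f = 0)
    (h2 : v ⬝ᵥ v = 0) : ∃ c : ℂ, v = c • axisVec f := by
  have e := sum_dotProduct_smul_complexify (axisFrame f) v
  have e2 := sum_dotProduct_mul_dotProduct (axisFrame f) v v
  rw [Fin.sum_univ_three] at e e2
  rw [dotProduct_axisVec] at h1
  rw [h2] at e2
  set A := v ⬝ᵥ complexify (axisFrame f 0)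
  set B := v ⬝ᵥ complexify (axisFrame f 1)
  set C := v ⬝ᵥ complexify (axisFrame f 2)
  have hA : A = -Complex.I * B := by linear_combination h1
  have hC : C = 0 := by
    have : C * C = 0 := by
      rw [hA] at e2
      linear_combination e2 - B * B * Complex.I_mul_I
    simpa using this
  have hB : B = A * Complex.I := by
    rw [hA]
    linear_combination B * Complex.I_mul_I
  refine ⟨A, ?_⟩
  conv_lhs => rw [← e, hC, zero_smul, add_zero, hB]
  rw [axisVec, smul_add, smul_smul]

theorem exists_eq_smul_axisVec {v : Fin 3 → ℂ} (h : v ⬝ᵥ v = 0) :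
    ∃ (f : OrientedAxis) (c : ℂ), v = c • axisVec f := by
  let a : E3 := WithLp.toLp 2 fun k => (v k).re
  let b : E3 := WithLp.toLp 2 fun k => (v k).im
  have hv : v = complexify a + Complex.I • complexify b := by
    ext k
    simp only [Pi.add_apply, Pi.smul_apply, complexify, a, b, smul_eq_mul]
    rw [mul_comm]
    exact (Complex.re_add_im _).symm
  -- The real and imaginary parts span at most a plane, so some unit vector is orthogonal to both;
  -- it is the axis.
  obtain ⟨L, hL, ha, hb⟩ : ∃ L : E3, ‖L‖ = 1 ∧ inner ℝ a L = 0 ∧ inner ℝ b L = 0 := by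
    let K := Submodule.span ℝ ({a, b} : Set E3)
    have h1 : Module.finrank ℝ K ≤ 2 := by
      classical
      have := (finrank_span_finset_le_card (R := ℝ) ({a, b} : Finset E3)).trans Finset.card_le_two
      rwa [Finset.coe_pair] at this
    have h2 := K.finrank_add_finrank_orthogonal
    rw [finrank_euclideanSpace_fin] at h2
    have h3 : Kᗮ ≠ ⊥ := by
      intro h
      rw [h, finrank_bot] at h2
      omega
    obtain ⟨x, hx, hx0⟩ := Submodule.exists_mem_ne_zero_of_ne_bot h3
    refine ⟨‖x‖⁻¹ • x, norm_smul_inv_norm hx0, ?_, ?_⟩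
    · rw [inner_smul_right, (Submodule.mem_orthogonal K x).1 hx a
        (Submodule.subset_span (by simp)), mul_zero]
    · rw [inner_smul_right, (Submodule.mem_orthogonal K x).1 hx b
        (Submodule.subset_span (by simp)), mul_zero]
  have hC : v ⬝ᵥ complexify L = 0 := by
    rw [hv, add_dotProduct, smul_dotProduct, complexify_dotProduct_complexify,
      complexify_dotProduct_complexify, ha, hb]
    simp
  let S : Metric.sphere (0 : E3) 1 := ⟨L, by simpa using hL⟩
  obtain ⟨e, he⟩ : ∃ e, e = (exists_orthonormalBasis_two_eq S).choose := ⟨_, rfl⟩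
  have he2 : e 2 = L := he ▸ (exists_orthonormalBasis_two_eq S).choose_spec
  have h0 := sum_dotProduct_mul_dotProduct e v v
  rw [Fin.sum_univ_three, he2, hC, h] at h0
  -- Up to the factor `i` this is `A² + B² = (A + iB)(A - iB)`; the two factors correspond to the
  -- two orientations of the axis.
  have h0' : (v ⬝ᵥ complexify (e 0) + Complex.I * (v ⬝ᵥ complexify (e 1))) *
      (v ⬝ᵥ complexify (e 1) + Complex.I * (v ⬝ᵥ complexify (e 0))) = 0 := by
    linear_combination Complex.I * h0 +
      (v ⬝ᵥ complexify (e 0)) * (v ⬝ᵥ complexify (e 1)) * Complex.I_mul_I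
  rcases mul_eq_zero.1 h0' with h1 | h1
  · refine ⟨(S, true), eq_smul_axisVec ?_ h⟩
    rw [dotProduct_axisVec, axisFrame, if_pos rfl, ← he, h1]
  · refine ⟨(S, false), eq_smul_axisVec ?_ h⟩
    rw [dotProduct_axisVec, axisFrame, if_neg (by simp), OrthonormalBasis.reindex_apply,
      OrthonormalBasis.reindex_apply, ← he]
    simpa using h1

end IsotropicVectors

/-! ### Projections along an axis in complex coordinates. -/

section Axes

theorem sub_mem_span_of_axisCoord_eq {f : OrientedAxis} {q q' : E3}
    (h : axisCoord f q = axisCoord f q') : q - q' ∈ Submodule.span ℝ {(f.1 : E3)} := by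
  have h0 : inner ℝ (axisFrame f 0) (q - q') = 0 := by
    have := congr_arg Complex.re h
    simp only [axisCoord, Complex.add_re, Complex.ofReal_re, Complex.re_ofReal_mul, Complex.I_re,
      mul_zero, add_zero] at this
    rw [inner_sub_right, this, sub_self]
  have h1 : inner ℝ (axisFrame f 1) (q - q') = 0 := by
    have := congr_arg Complex.im h
    simp only [axisCoord, Complex.add_im, Complex.ofReal_im, Complex.im_ofReal_mul, Complex.I_im,
      mul_one, zero_add] at this
    rw [inner_sub_right, this, sub_self]
  have := (axisFrame f).sum_repr' (q - q')
  rw [Fin.sum_univ_three, h0, h1, zero_smul, zero_smul, zero_add, zero_add, axisFrame_two] at this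
  rw [← this]
  exact Submodule.smul_mem _ _ (Submodule.mem_span_singleton_self _)

theorem collinear_of_axisCoord_eq {f : OrientedAxis} {s : Set E3}
    (h : ∀ q ∈ s, ∀ q' ∈ s, axisCoord f q = axisCoord f q') : Collinear ℝ s := by
  rcases s.eq_empty_or_nonempty with rfl | ⟨q₀, h₀⟩
  · exact collinear_empty ℝ E3
  rw [collinear_iff_of_mem h₀]
  refine ⟨(f.1 : E3), fun q hq => ?_⟩
  obtain ⟨t, ht⟩ := Submodule.mem_span_singleton.1 (sub_mem_span_of_axisCoord_eq (h q hq q₀ h₀))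
  exact ⟨t, by rw [ht, vadd_eq_add, sub_add_cancel]⟩

/-- The axis must be plus or minus the normalized difference of the points, with two orientations
each. -/
theorem finite_setOf_axisCoord_eq {q q' : E3} (h : q ≠ q') :
    {f : OrientedAxis | axisCoord f q = axisCoord f q'}.Finite := by
  have hfin : ({L : Metric.sphere (0 : E3) 1 | (L : E3) ∈
      ({‖q - q'‖⁻¹ • (q - q'), -(‖q - q'‖⁻¹ • (q - q'))} : Set E3)}).Finite :=
    Set.Finite.preimage Subtype.val_injective.injOn (by simp)
  refine (hfin.prod (Set.finite_univ (α := Bool))).subset fun f hf => ⟨?_, trivial⟩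
  obtain ⟨t, ht⟩ := Submodule.mem_span_singleton.1 (sub_mem_span_of_axisCoord_eq hf)
  have hL : ‖(f.1 : E3)‖ = 1 := by simp
  have ht0 : t ≠ 0 := by
    rintro rfl
    rw [zero_smul] at ht
    exact h (sub_eq_zero.1 ht.symm)
  have hn : ‖q - q'‖ = |t| := by rw [← ht, norm_smul, hL, mul_one, Real.norm_eq_abs]
  show (f.1 : E3) ∈ ({_, _} : Set E3)
  rw [Set.mem_insert_iff, Set.mem_singleton_iff, hn, ← ht, smul_smul]
  rcases abs_cases t with ⟨h1, -⟩ | ⟨h1, -⟩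
  · left
    rw [h1, inv_mul_cancel₀ ht0, one_smul]
  · right
    rw [h1, inv_neg, neg_mul, inv_mul_cancel₀ ht0, neg_smul, one_smul, neg_neg]

/-- The complex coordinate as an isometry of the plane orthogonal to an axis onto the complex
plane. -/
theorem exists_isometryEquiv_axisCoord (f : OrientedAxis) :
    ∃ Φ : orthPlane (f.1 : E3) ≃ₗᵢ[ℝ] ℂ, ∀ q, Φ (orthProj f.1 q) = axisCoord f q := by
  have hinner : ∀ q : E3, ∀ i : Fin 3, i ≠ 2 →
      inner ℝ (axisFrame f i) (orthProj f.1 q : E3) = inner ℝ (axisFrame f i) q := by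
    intro q i hi
    have hmem : axisFrame f i ∈ orthPlane (f.1 : E3) := by
      rw [Submodule.mem_orthogonal_singleton_iff_inner_right, ← axisFrame_two f,
        OrthonormalBasis.inner_eq_ite, if_neg (Ne.symm hi)]
    have := Submodule.inner_orthogonalProjectionOnto_eq_of_mem_right (K := orthPlane (f.1 : E3))
      ⟨_, hmem⟩ q
    rw [real_inner_comm, real_inner_comm q]
    exact this
  let φ : orthPlane (f.1 : E3) →ₗ[ℝ] ℂ :=
    { toFun := fun q => axisCoord f q
      map_add' := fun a b => by
        simp only [axisCoord, Submodule.coe_add, inner_add_right]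
        push_cast
        ring
      map_smul' := fun c a => by
        simp only [axisCoord, Submodule.coe_smul, inner_smul_right, RingHom.id_apply]
        push_cast
        rw [Complex.real_smul]
        ring }
  let Φ : orthPlane (f.1 : E3) →ₗᵢ[ℝ] ℂ := ⟨φ, fun q => by
    have h2 : inner ℝ (axisFrame f 2) (q : E3) = 0 := by
      rw [axisFrame_two]
      exact Submodule.mem_orthogonal_singleton_iff_inner_right.1 q.2
    have h := (axisFrame f).sum_sq_norm_inner_right (q : E3)
    rw [Fin.sum_univ_three, h2, norm_zero, Real.norm_eq_abs, Real.norm_eq_abs, sq_abs, sq_abs] at h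
    rw [← sq_eq_sq₀ (norm_nonneg _) (norm_nonneg _), Submodule.coe_norm, ← h, Complex.sq_norm]
    show Complex.normSq (axisCoord f q) = _
    rw [axisCoord, Complex.normSq_add_mul_I]
    ring⟩
  have hne : (f.1 : E3) ≠ 0 := by
    intro h
    have hL : ‖(f.1 : E3)‖ = 1 := by simp
    rw [h, norm_zero] at hL
    exact zero_ne_one hL
  have : Fact (Module.finrank ℝ E3 = 2 + 1) := ⟨by simp⟩
  refine ⟨Φ.toLinearIsometryEquiv ?_, fun q => ?_⟩
  · rw [Complex.finrank_real_complex]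
    exact Submodule.finrank_orthogonal_span_singleton hne
  · show axisCoord f (orthProj f.1 q : E3) = axisCoord f q
    rw [axisCoord, axisCoord, hinner q 0 (by decide), hinner q 1 (by decide)]

theorem differBySimilarity_of_axisCoord {n : ℕ} {f g : OrientedAxis} {p P : Fin n → E3}
    {a b : ℂ} (ha : a ≠ 0) (h : ∀ i, axisCoord g (P i) = a * axisCoord f (p i) + b) :
    DifferBySimilarity (fun i => orthProj f.1 (p i)) fun i => orthProj g.1 (P i) := by
  obtain ⟨Φ, hΦ⟩ := exists_isometryEquiv_axisCoord f
  obtain ⟨Ψ, hΨ⟩ := exists_isometryEquiv_axisCoord g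
  refine ⟨(Φ.toIsometryEquiv.toDilationEquiv.trans (DilationEquiv.smulTorsor b ha)).trans
    Ψ.toIsometryEquiv.symm.toDilationEquiv, fun i => ?_⟩
  show Ψ.symm (a • Φ (orthProj f.1 (p i)) +ᵥ b) = _
  rw [hΦ, LinearIsometryEquiv.symm_apply_eq, hΨ, h, smul_eq_mul, vadd_eq_add]

theorem differByInversion_of_axisCoord {n : ℕ} {f g : OrientedAxis} {p P : Fin n → E3}
    {a b k : ℂ} (hk : k ≠ 0)
    (h : ∀ i, (axisCoord f (p i) - a) * (axisCoord g (P i) - b) = k) :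
    DifferByInversion (fun i => orthProj f.1 (p i)) fun i => orthProj g.1 (P i) := by
  obtain ⟨Φ, hΦ⟩ := exists_isometryEquiv_axisCoord f
  obtain ⟨Ψ, hΨ⟩ := exists_isometryEquiv_axisCoord g
  have hk' : (‖k‖ : ℂ) ≠ 0 := by simpa using hk
  -- In coordinates the inversion of radius `√‖k‖` sends `z` to `a + ‖k‖ / conj (z - a)`.
  -- Subtracting `a`, conjugating, rotating by `u` and adding `b` yields `k / (z - a) + b`.
  let u : Circle := ⟨k / ‖k‖, by simp [Submonoid.unitSphere, hk]⟩
  let ψ : orthPlane (f.1 : E3) ≃ᵢ orthPlane (g.1 : E3) :=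
    (Φ.toIsometryEquiv.trans (IsometryEquiv.subRight a)).trans
      ((Complex.conjLIE.trans (rotation u)).toIsometryEquiv.trans
        ((IsometryEquiv.addRight b).trans Ψ.toIsometryEquiv.symm))
  refine ⟨Φ.symm a, √‖k‖, ψ, by positivity, fun i => ⟨fun hi => hk ?_, ?_⟩⟩
  · have hi' : orthProj f.1 (p i) = Φ.symm a := hi
    rw [← h i, ← hΦ, hi', LinearIsometryEquiv.apply_symm_apply, sub_self, zero_mul]
  · have hza : axisCoord f (p i) - a ≠ 0 := by
      intro h0
      rw [← h i, h0, zero_mul] at hk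
      exact hk rfl
    have hdist : dist (orthProj f.1 (p i)) (Φ.symm a) = ‖axisCoord f (p i) - a‖ := by
      rw [← Φ.dist_map, LinearIsometryEquiv.apply_symm_apply, hΦ, dist_eq_norm]
    have hω : axisCoord g (P i) = k / (axisCoord f (p i) - a) + b := by
      rw [← h i]
      field_simp
      ring
    have hinv : Φ (EuclideanGeometry.inversion (Φ.symm a) √‖k‖ (orthProj f.1 (p i))) - a =
        ((‖k‖ / ‖axisCoord f (p i) - a‖ ^ 2 : ℝ) : ℂ) * (axisCoord f (p i) - a) := by
      rw [EuclideanGeometry.inversion, hdist, vadd_eq_add, vsub_eq_sub, Φ.map_add, Φ.map_smul,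
        Φ.map_sub, hΦ, LinearIsometryEquiv.apply_symm_apply, add_sub_cancel_right,
        Complex.real_smul, div_pow, Real.sq_sqrt (norm_nonneg k)]
    show Ψ.symm (((k / ‖k‖ : ℂ) * (starRingEnd ℂ) (Φ (EuclideanGeometry.inversion (Φ.symm a) √‖k‖
      (orthProj f.1 (p i))) - a)) + b) = _
    rw [LinearIsometryEquiv.symm_apply_eq, hΨ, hω, hinv, map_mul, Complex.conj_ofReal]
    congr 1
    set w := axisCoord f (p i) - a
    have hw : (starRingEnd ℂ) w * w = (‖w‖ : ℂ) ^ 2 := by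
      rw [mul_comm, Complex.mul_conj, Complex.normSq_eq_norm_sq]
      push_cast
      rfl
    have hw0 : (‖w‖ : ℂ) ≠ 0 := by simpa using hza
    push_cast
    rw [eq_div_iff hza]
    field_simp
    linear_combination hw

theorem exists_parallel_lines {f : OrientedAxis} {q q' : E3}
    (h : axisCoord f q ≠ axisCoord f q') : ∃ g g' : AffineSubspace ℝ E3, IsLine g ∧ IsLine g' ∧
      g.Parallel g' ∧ g ≠ g' ∧ (∀ s, axisCoord f s = axisCoord f q → s ∈ g) ∧
      ∀ s, axisCoord f s = axisCoord f q' → s ∈ g' := by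
  let D := Submodule.span ℝ {(f.1 : E3)}
  have hne : (f.1 : E3) ≠ 0 := by
    intro h
    have hL : ‖(f.1 : E3)‖ = 1 := by simp
    rw [h, norm_zero] at hL
    exact zero_ne_one hL
  have hline : ∀ s, IsLine (AffineSubspace.mk' s D) := fun s =>
    ⟨⟨s, AffineSubspace.self_mem_mk' _ _⟩, by
      rw [AffineSubspace.direction_mk']
      exact finrank_span_singleton hne⟩
  have hcoord : ∀ s ∈ D, axisCoord f s = 0 := by
    intro s hs
    obtain ⟨t, rfl⟩ := Submodule.mem_span_singleton.1 hs
    rw [axisCoord, ← axisFrame_two, inner_smul_right, inner_smul_right,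
      OrthonormalBasis.inner_eq_ite, OrthonormalBasis.inner_eq_ite, if_neg (by decide),
      if_neg (by decide)]
    simp
  refine ⟨AffineSubspace.mk' q D, AffineSubspace.mk' q' D, hline q, hline q', ?_, ?_, ?_, ?_⟩
  · rw [AffineSubspace.parallel_iff_direction_eq_and_eq_bot_iff_eq_bot]
    refine ⟨by rw [AffineSubspace.direction_mk', AffineSubspace.direction_mk'], ?_⟩
    have hbot : ∀ s, AffineSubspace.mk' s D ≠ ⊥ := fun s =>
      (AffineSubspace.nonempty_iff_ne_bot _).1 (hline s).1
    exact iff_of_false (hbot q) (hbot q')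
  · intro heq
    have hq : q ∈ AffineSubspace.mk' q' D := heq ▸ AffineSubspace.self_mem_mk' q D
    rw [AffineSubspace.mem_mk', vsub_eq_sub] at hq
    have := hcoord _ hq
    rw [← complexify_dotProduct_axisVec] at this
    apply h
    rw [← complexify_dotProduct_axisVec, ← complexify_dotProduct_axisVec, ← sub_eq_zero,
      ← sub_dotProduct, ← this]
    congr 1
    ext k
    simp [complexify]
  · intro s hs
    exact AffineSubspace.mem_mk'.2 (sub_mem_span_of_axisCoord_eq hs)
  · intro s hs
    exact AffineSubspace.mem_mk'.2 (sub_mem_span_of_axisCoord_eq hs)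

end Axes

/-! ### Points at infinity and their bilinear leg relations. -/

section Bonds

/-- The point at infinity with rotational part a multiple of the tensor product of two isotropic
vectors and translational parts multiples of these vectors. -/
def bond (φ : OrientedAxis × OrientedAxis) (c : Fin 4 → ℂ) : Coord → ℂ
  | m i j => c 0 * axisVec φ.2 i * axisVec φ.1 j
  | x i => c 1 * axisVec φ.1 i
  | y i => c 2 * axisVec φ.2 i
  | r => c 3

theorem bond_smul (φ : OrientedAxis × OrientedAxis) (t : ℂ) (c : Fin 4 → ℂ) :
    bond φ (t • c) = t • bond φ c := by
  ext s
  cases s <;> simp [bond, mul_assoc]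

theorem bond_ne_zero (φ : OrientedAxis × OrientedAxis) {c : Fin 4 → ℂ} (hc : c ≠ 0) :
    bond φ c ≠ 0 := by
  intro h
  obtain ⟨j, hj⟩ := Function.ne_iff.1 (axisVec_ne_zero φ.1)
  obtain ⟨i, hi⟩ := Function.ne_iff.1 (axisVec_ne_zero φ.2)
  simp only [Pi.zero_apply] at hi hj
  have h0 : c 0 = 0 := by
    have : c 0 * axisVec φ.2 i * axisVec φ.1 j = 0 := congr_fun h (m i j)
    simpa [hi, hj] using this
  have h1 : c 1 = 0 := by
    have : c 1 * axisVec φ.1 j = 0 := congr_fun h (x j)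
    simpa [hj] using this
  have h2 : c 2 = 0 := by
    have : c 2 * axisVec φ.2 i = 0 := congr_fun h (y i)
    simpa [hi] using this
  have h3 : c 3 = 0 := congr_fun h r
  apply hc
  ext k
  fin_cases k <;> assumption

/-- The bilinear form by which a leg condition restricts to the points at infinity. -/
def legForm (c : Fin 4 → ℂ) (ζ ω : ℂ) : ℂ :=
  c 3 - 2 * c 1 * ζ - 2 * c 2 * ω - 2 * c 0 * ζ * ω

variable {n : ℕ}

/-- The forms that annihilate the projections of the platform and base points along two axes. -/
def legSolutions (p P : Fin n → E3) (φ : OrientedAxis × OrientedAxis) : Set (Fin 4 → ℂ) :=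
  {c | c ≠ 0 ∧ ∀ i, legForm c (axisCoord φ.1 (p i)) (axisCoord φ.2 (P i)) = 0}

/-- If `M ≠ 0`, its rows are isotropic and pairwise orthogonal, hence multiples of one isotropic
vector; the coefficients form an isotropic vector as well, by `MᵗM = 0`. Then `Mx = 0` and `Mᵗy = 0`
tie `x` and `y` to the same two vectors. If `M = 0`, the isotropic `x` and `y` supply the axes. -/
theorem NPod.IsBond.exists_coefficients {T : NPod n} {z : Coord → ℂ} (h : T.IsBond z) :
    ∃ (φ : OrientedAxis × OrientedAxis) (c : Fin 4 → ℂ), z = bond φ c := by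
  by_cases hM : matM z = 0
  · obtain ⟨f, μ, hμ⟩ := exists_eq_smul_axisVec h.xx
    obtain ⟨g, ν, hν⟩ := exists_eq_smul_axisVec h.yy
    refine ⟨(f, g), ![0, μ, ν, z r], ?_⟩
    ext s
    cases s with
    | m i j => simpa [bond, matM] using congr_fun (congr_fun hM i) j
    | x i => simpa [bond, vecX] using congr_fun hμ i
    | y i => simpa [bond, vecY] using congr_fun hν i
    | r => rfl
  · obtain ⟨i₀, hi₀⟩ := Function.ne_iff.1 hM
    have hrow : ∀ i j, matM z i ⬝ᵥ matM z j = 0 := fun i j =>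
      congr_fun (congr_fun h.mul_transpose i) j
    obtain ⟨f, c, hc⟩ := exists_eq_smul_axisVec (hrow i₀ i₀)
    have hc0 : c ≠ 0 := by
      rintro rfl
      rw [zero_smul] at hc
      exact hi₀ hc
    have horth : ∀ v : Fin 3 → ℂ, v ⬝ᵥ matM z i₀ = 0 → v ⬝ᵥ axisVec f = 0 := by
      intro v hv
      rw [hc, dotProduct_smul, smul_eq_mul] at hv
      exact (mul_eq_zero.1 hv).resolve_left hc0
    choose u hu using fun i => eq_smul_axisVec (horth _ (hrow i i₀)) (hrow i i)
    have hu' : ∀ i j, matM z i j = u i * axisVec f j := fun i j => congr_fun (hu i) j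
    obtain ⟨j, hj⟩ := Function.ne_iff.1 (axisVec_ne_zero f)
    simp only [Pi.zero_apply] at hj
    have huu : u ⬝ᵥ u = 0 := by
      have := congr_fun (congr_fun h.transpose_mul j) j
      rw [Matrix.mul_apply] at this
      simp only [Matrix.transpose_apply, hu', Matrix.zero_apply, Fin.sum_univ_three] at this
      have h2 : (u ⬝ᵥ u) * (axisVec f j * axisVec f j) = 0 := by
        rw [dotProduct, Fin.sum_univ_three]
        linear_combination this
      exact (mul_eq_zero.1 h2).resolve_right (mul_ne_zero hj hj)
    obtain ⟨g, l, hl⟩ := exists_eq_smul_axisVec huu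
    have hl0 : l ≠ 0 := by
      rintro rfl
      rw [zero_smul] at hl
      apply hi₀
      rw [hu, hl, Pi.zero_apply, zero_smul]
      rfl
    obtain ⟨μ, hμ⟩ : ∃ μ, vecX z = μ • axisVec f := by
      refine eq_smul_axisVec (horth _ ?_) h.xx
      rw [dotProduct_comm]
      exact congr_fun h.mulVec i₀
    obtain ⟨ν, hν⟩ : ∃ ν, vecY z = ν • axisVec g := by
      refine eq_smul_axisVec ?_ h.yy
      have := congr_fun h.transpose_mulVec j
      simp only [Matrix.mulVec, dotProduct, Matrix.transpose_apply, hu', hl, Pi.smul_apply,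
        Pi.zero_apply, Fin.sum_univ_three, smul_eq_mul] at this
      have h2 : (vecY z ⬝ᵥ axisVec g) * (l * axisVec f j) = 0 := by
        rw [dotProduct, Fin.sum_univ_three]
        linear_combination this
      exact (mul_eq_zero.1 h2).resolve_right (mul_ne_zero hl0 hj)
    refine ⟨(f, g), ![l, μ, ν, z r], ?_⟩
    ext s
    cases s with
    | m i j => simpa [bond, matM, hl] using hu' i j
    | x i => simpa [bond, vecX] using congr_fun hμ i
    | y i => simpa [bond, vecY] using congr_fun hν i
    | r => rfl

theorem NPod.IsBond.legForm_eq_zero {T : NPod n} {φ : OrientedAxis × OrientedAxis}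
    {c : Fin 4 → ℂ} (h : T.IsBond (bond φ c)) (i : Fin n) :
    legForm c (axisCoord φ.1 (T.p i)) (axisCoord φ.2 (T.P i)) = 0 := by
  have := h.leg i
  rw [← complexify_dotProduct_axisVec, ← complexify_dotProduct_axisVec, legForm]
  simp only [Matrix.mulVec, dotProduct, vecX, vecY, matM, Matrix.of_apply, Fin.sum_univ_three,
    bond] at this ⊢
  linear_combination this

/-- A pencil of forms has a member through any prescribed point. -/
theorem exists_legForm_eq_zero_of_not_proportional {c c' : Fin 4 → ℂ} (hc : c ≠ 0)
    (hcc' : ∀ t : ℂ, c' ≠ t • c) (ζ ω : ℂ) : ∃ d : Fin 4 → ℂ, d ≠ 0 ∧ legForm d ζ ω = 0 ∧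
      ∀ ζ' ω', legForm c ζ' ω' = 0 → legForm c' ζ' ω' = 0 → legForm d ζ' ω' = 0 := by
  by_cases h : legForm c ζ ω = 0
  · exact ⟨c, hc, h, fun _ _ h _ => h⟩
  have hlin : ∀ ζ' ω', legForm (c' - (legForm c' ζ ω / legForm c ζ ω) • c) ζ' ω' =
      legForm c' ζ' ω' - legForm c' ζ ω / legForm c ζ ω * legForm c ζ' ω' := by
    intro ζ' ω'
    rw [legForm, legForm.eq_1 c' ζ' ω', legForm.eq_1 c ζ' ω']
    simp only [Pi.sub_apply, Pi.smul_apply, smul_eq_mul]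
    ring
  refine ⟨_, sub_ne_zero.2 (hcc' (legForm c' ζ ω / legForm c ζ ω)), ?_, fun ζ' ω' h1 h2 => ?_⟩
  · rw [hlin, div_mul_cancel₀ _ h, sub_self]
  · rw [hlin, h1, h2, mul_zero, sub_zero]

/-- Vanishing at three corners of a rectangle forces the form to be a multiple of `(ζ - ζ₁)(ω -
ω₂)`. -/
theorem mul_eq_zero_of_legForm_eq_zero {d : Fin 4 → ℂ} (hd : d ≠ 0) {ζ₁ ζ₂ ω₁ ω₂ : ℂ}
    (hζ : ζ₁ ≠ ζ₂) (hω : ω₁ ≠ ω₂) (h11 : legForm d ζ₁ ω₁ = 0) (h12 : legForm d ζ₁ ω₂ = 0)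
    (h22 : legForm d ζ₂ ω₂ = 0) {ζ ω : ℂ} (h : legForm d ζ ω = 0) : ζ = ζ₁ ∨ ω = ω₂ := by
  unfold legForm at *
  have e2 : d 2 = -d 0 * ζ₁ := by
    have : (ω₁ - ω₂) * (d 2 + d 0 * ζ₁) = 0 := by linear_combination (h12 - h11) / 2
    linear_combination (mul_eq_zero.1 this).resolve_left (sub_ne_zero.2 hω)
  have e1 : d 1 = -d 0 * ω₂ := by
    have : (ζ₁ - ζ₂) * (d 1 + d 0 * ω₂) = 0 := by linear_combination (h22 - h12) / 2
    linear_combination (mul_eq_zero.1 this).resolve_left (sub_ne_zero.2 hζ)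
  have e3 : d 3 = -2 * d 0 * ζ₁ * ω₂ := by
    rw [e1, e2] at h12
    linear_combination h12
  have e0 : d 0 ≠ 0 := by
    intro e0
    apply hd
    rw [e0] at e1 e2 e3
    ext k
    fin_cases k
    · exact e0
    · simpa using e1
    · simpa using e2
    · simpa using e3
  have : (ζ - ζ₁) * (ω - ω₂) = 0 := by
    apply (mul_eq_zero.1 _).resolve_left (mul_ne_zero (two_ne_zero (α := ℂ)) e0)
    rw [e1, e2, e3] at h
    linear_combination -h
  rcases mul_eq_zero.1 this with h | h
  · exact Or.inl (sub_eq_zero.1 h)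
  · exact Or.inr (sub_eq_zero.1 h)

/-- The common zeros of two independent forms lie on a ruling or form at most two points. -/
theorem common_zeros_of_not_proportional {ι : Type*} {ζ ω : ι → ℂ} {c c' : Fin 4 → ℂ} (hc : c ≠ 0)
    (hcc' : ∀ t : ℂ, c' ≠ t • c) (h : ∀ i, legForm c (ζ i) (ω i) = 0)
    (h' : ∀ i, legForm c' (ζ i) (ω i) = 0) :
    (∀ i j, ζ i = ζ j) ∨ (∀ i j, ω i = ω j) ∨ ∃ i j, ζ i ≠ ζ j ∧ ω i ≠ ω j ∧
      ∀ k, (ζ k = ζ i ∧ ω k = ω i) ∨ (ζ k = ζ j ∧ ω k = ω j) := by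
  by_cases hall : ∀ i j, ζ i = ζ j ∨ ω i = ω j
  · by_cases h1 : ∀ i j, ζ i = ζ j
    · exact Or.inl h1
    push Not at h1
    obtain ⟨a, b, hab⟩ := h1
    have hω : ω a = ω b := (hall a b).resolve_left hab
    have key : ∀ k, ω k = ω a := by
      intro k
      by_contra hk
      have e1 := (hall k a).resolve_right hk
      have e2 := (hall k b).resolve_right (hω ▸ hk)
      exact hab (e1.symm.trans e2)
    exact Or.inr (Or.inl fun i j => (key i).trans (key j).symm)
  · push Not at hall
    obtain ⟨i, j, hζ, hω⟩ := hall
    refine Or.inr (Or.inr ⟨i, j, hζ, hω, fun k => ?_⟩)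
    -- The points `i` and `j` are opposite corners of a rectangle. The pencil members through the
    -- two other corners split into lines, and these line pairs meet only in `i` and `j`.
    obtain ⟨d, hd, hd0, hd1⟩ := exists_legForm_eq_zero_of_not_proportional hc hcc' (ζ i) (ω j)
    obtain ⟨e, he, he0, he1⟩ := exists_legForm_eq_zero_of_not_proportional hc hcc' (ζ j) (ω i)
    have hd2 := fun k => hd1 _ _ (h k) (h' k)
    have he2 := fun k => he1 _ _ (h k) (h' k)
    have k1 := mul_eq_zero_of_legForm_eq_zero hd hζ hω (hd2 i) hd0 (hd2 j) (hd2 k)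
    have k2 := mul_eq_zero_of_legForm_eq_zero he hζ.symm hω.symm (he2 j) he0 (he2 i) (he2 k)
    rcases k1 with k1 | k1
    · rcases k2 with k2 | k2
      · exact absurd (k1.symm.trans k2) hζ
      · exact Or.inl ⟨k1, k2⟩
    · rcases k2 with k2 | k2
      · exact Or.inr ⟨k2, k1⟩
      · exact absurd (k2.symm.trans k1) hω

end Bonds

/-! ### Splittings of the legs and finiteness of the admissible axes. -/

section Splittings

variable {n : ℕ}

/-- Up to a permutation of the indices and an interchange of the two families, a first part of one
family is collinear and the complementary part of the other family coincides. -/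
def CollinearCoincident (p P : Fin n → E3) : Prop :=
  ∃ (m : ℕ) (τ : Equiv.Perm (Fin n)), m ≤ n ∧
    ((Collinear ℝ {q | ∃ i : Fin n, (i : ℕ) < m ∧ q = p (τ i)} ∧
        ∀ i j : Fin n, m ≤ (i : ℕ) → m ≤ (j : ℕ) → P (τ i) = P (τ j)) ∨
      (Collinear ℝ {q | ∃ i : Fin n, (i : ℕ) < m ∧ q = P (τ i)} ∧
        ∀ i j : Fin n, m ≤ (i : ℕ) → m ≤ (j : ℕ) → p (τ i) = p (τ j)))

/-- Up to a permutation of the indices, both families lie on two parallel lines, with the same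
distribution of the indices. -/
def OnParallelLines (p P : Fin n → E3) : Prop :=
  ∃ (m : ℕ) (τ : Equiv.Perm (Fin n)) (g g' G G' : AffineSubspace ℝ E3),
    1 < m ∧ m + 1 < n ∧
    IsLine g ∧ IsLine g' ∧ g.Parallel g' ∧ g ≠ g' ∧
    IsLine G ∧ IsLine G' ∧ G.Parallel G' ∧ G ≠ G' ∧
    ∀ i : Fin n,
      ((i : ℕ) < m → p (τ i) ∈ g ∧ P (τ i) ∈ G) ∧
      (m ≤ (i : ℕ) → p (τ i) ∈ g' ∧ P (τ i) ∈ G')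

theorem CollinearCoincident.symm {p P : Fin n → E3} (h : CollinearCoincident p P) :
    CollinearCoincident P p := by
  obtain ⟨m, τ, hm, h⟩ := h
  exact ⟨m, τ, hm, h.symm⟩

theorem exists_perm_lt_card_iff_mem (S : Finset (Fin n)) :
    ∃ τ : Equiv.Perm (Fin n), ∀ i : Fin n, (i : ℕ) < S.card ↔ τ i ∈ S := by
  have hS : S.card ≤ n := by simpa using S.card_le_univ
  have hcard : Fintype.card {i : Fin n // (i : ℕ) < S.card} = Fintype.card {i // i ∈ S} := by
    rw [Fintype.card_coe, Fintype.card_subtype, Fin.card_filter_val_lt, min_eq_right hS]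
  let e := Fintype.equivOfCardEq hcard
  refine ⟨e.extendSubtype, fun i => ⟨e.extendSubtype_mem i, fun h => ?_⟩⟩
  by_contra hi
  exact e.extendSubtype_not_mem i hi h

theorem collinearCoincident_of_finset {p P : Fin n → E3} (S : Finset (Fin n))
    (hp : Collinear ℝ (p '' S)) (hP : ∀ i, i ∉ S → ∀ j, j ∉ S → P i = P j) :
    CollinearCoincident p P := by
  obtain ⟨τ, hτ⟩ := exists_perm_lt_card_iff_mem S
  refine ⟨S.card, τ, by simpa using S.card_le_univ, Or.inl ⟨hp.subset ?_, fun i j hi hj => ?_⟩⟩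
  · rintro q ⟨i, hi, rfl⟩
    exact ⟨τ i, (hτ i).1 hi, rfl⟩
  · exact hP _ (mt (hτ i).2 hi.not_gt) _ (mt (hτ j).2 hj.not_gt)

theorem collinear_image_of_axisCoord_eq {f : OrientedAxis} {p : Fin n → E3} {S : Finset (Fin n)}
    {a : ℂ} (h : ∀ i ∈ S, axisCoord f (p i) = a) : Collinear ℝ (p '' S) := by
  refine collinear_of_axisCoord_eq (f := f) ?_
  rintro _ ⟨i, hi, rfl⟩ _ ⟨j, hj, rfl⟩
  exact (h i hi).trans (h j hj).symm

theorem collinearCoincident_of_axisCoord_eq {f : OrientedAxis} {p : Fin n → E3} (P : Fin n → E3)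
    (h : ∀ i j, axisCoord f (p i) = axisCoord f (p j)) : CollinearCoincident p P := by
  refine collinearCoincident_of_finset Finset.univ (collinear_of_axisCoord_eq (f := f) ?_)
    fun i hi => absurd (Finset.mem_univ i) hi
  rintro _ ⟨i, -, rfl⟩ _ ⟨j, -, rfl⟩
  exact h i j

theorem split_of_not_proportional {p P : Fin n → E3} {φ : OrientedAxis × OrientedAxis}
    {c c' : Fin 4 → ℂ} (hc : c ∈ legSolutions p P φ) (hc' : c' ∈ legSolutions p P φ)
    (hcc' : ∀ t : ℂ, c' ≠ t • c) : CollinearCoincident p P ∨ OnParallelLines p P := by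
  classical
  rcases common_zeros_of_not_proportional hc.1 hcc' hc.2 hc'.2 with h | h | ⟨a, b, hζ, hω, h⟩
  · exact Or.inl (collinearCoincident_of_axisCoord_eq P h)
  · exact Or.inl (collinearCoincident_of_axisCoord_eq p h).symm
  let S : Finset (Fin n) := Finset.univ.filter fun k => axisCoord φ.1 (p k) = axisCoord φ.1 (p a)
  have hS : ∀ k ∈ S, axisCoord φ.1 (p k) = axisCoord φ.1 (p a) ∧
      axisCoord φ.2 (P k) = axisCoord φ.2 (P a) := by
    intro k hk
    have hk' := (Finset.mem_filter.1 hk).2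
    exact (h k).resolve_right fun h2 => hζ (hk'.symm.trans h2.1)
  have hS' : ∀ k, k ∉ S → axisCoord φ.1 (p k) = axisCoord φ.1 (p b) ∧
      axisCoord φ.2 (P k) = axisCoord φ.2 (P b) := by
    intro k hk
    exact (h k).resolve_left fun h2 => hk (Finset.mem_filter.2 ⟨Finset.mem_univ k, h2.1⟩)
  -- A class with at most one leg is trivially coincident and the other is collinear, which is (b);
  -- so in (c) both classes have at least two legs.
  by_cases h1 : S.card ≤ 1
  · left
    refine collinearCoincident_of_finset Sᶜ (collinear_image_of_axisCoord_eq (f := φ.1)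
      fun i hi => (hS' i (Finset.mem_compl.1 hi)).1) fun i hi j hj => ?_
    rw [Finset.card_le_one.1 h1 i (by simpa using hi) j (by simpa using hj)]
  by_cases h2 : Sᶜ.card ≤ 1
  · left
    refine collinearCoincident_of_finset S (collinear_image_of_axisCoord_eq (f := φ.1)
      fun i hi => (hS i hi).1) fun i hi j hj => ?_
    rw [Finset.card_le_one.1 h2 i (by simpa using hi) j (by simpa using hj)]
  right
  obtain ⟨τ, hτ⟩ := exists_perm_lt_card_iff_mem S
  obtain ⟨g, g', l1, l2, l3, l4, l5, l6⟩ := exists_parallel_lines hζ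
  obtain ⟨G, G', k1, k2, k3, k4, k5, k6⟩ := exists_parallel_lines hω
  have hcard := S.card_add_card_compl
  rw [Fintype.card_fin] at hcard
  refine ⟨S.card, τ, g, g', G, G', by omega, by omega, l1, l2, l3, l4, k1, k2, k3, k4,
    fun i => ⟨fun hi => ?_, fun hi => ?_⟩⟩
  · have := hS _ ((hτ i).1 hi)
    exact ⟨l5 _ this.1, k5 _ this.2⟩
  · have := hS' _ (mt (hτ i).2 hi.not_gt)
    exact ⟨l6 _ this.1, k6 _ this.2⟩

theorem finite_axes_or_coincident {p : Fin n → E3} (S : Finset (Fin n)) :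
    {f : OrientedAxis | ∃ a, ∀ i ∈ S, axisCoord f (p i) = a}.Finite ∨
      ∀ i ∈ S, ∀ j ∈ S, p i = p j := by
  by_cases h : ∀ i ∈ S, ∀ j ∈ S, p i = p j
  · exact Or.inr h
  push Not at h
  obtain ⟨i, hi, j, hj, hij⟩ := h
  left
  refine (finite_setOf_axisCoord_eq hij).subset ?_
  rintro f ⟨a, ha⟩
  exact (ha i hi).trans (ha j hj).symm

/-- The pairs of axes such that, for every index, the platform point lies on a fixed parallel of
the first axis or the base point lies on a fixed parallel of the second axis. -/
def butterflyAxes (p P : Fin n → E3) : Set (OrientedAxis × OrientedAxis) :=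
  {φ | ∃ a b, ∀ i, axisCoord φ.1 (p i) = a ∨ axisCoord φ.2 (P i) = b}

/-- The pairs are covered by finitely many products `A S ×ˢ B S`. If both factors are nonempty and
one is infinite, its points coincide while the points of the other factor are collinear, which is
(b). -/
theorem finite_butterflyAxes {p P : Fin n → E3} (h : ¬CollinearCoincident p P) :
    (butterflyAxes p P).Finite := by
  classical
  let A : Finset (Fin n) → Set OrientedAxis := fun S =>
    {f | ∃ a, ∀ i ∈ S, axisCoord f (p i) = a}
  let B : Finset (Fin n) → Set OrientedAxis := fun S =>
    {f | ∃ b, ∀ i ∈ Sᶜ, axisCoord f (P i) = b}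
  have hsub : butterflyAxes p P ⊆ ⋃ S : Finset (Fin n), A S ×ˢ B S := by
    rintro φ ⟨a, b, hab⟩
    refine Set.mem_iUnion.2 ⟨Finset.univ.filter fun i => axisCoord φ.1 (p i) = a, ⟨a, ?_⟩, b, ?_⟩
    · intro i hi
      exact (Finset.mem_filter.1 hi).2
    · intro i hi
      refine (hab i).resolve_left fun h1 => Finset.mem_compl.1 hi ?_
      exact Finset.mem_filter.2 ⟨Finset.mem_univ i, h1⟩
  refine (Set.finite_iUnion fun S => ?_).subset hsub
  by_cases hA : (A S).Nonempty
  swap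
  · rw [Set.not_nonempty_iff_eq_empty.1 hA, Set.empty_prod]
    exact Set.finite_empty
  by_cases hB : (B S).Nonempty
  swap
  · rw [Set.not_nonempty_iff_eq_empty.1 hB, Set.prod_empty]
    exact Set.finite_empty
  obtain ⟨f, a, hf⟩ := hA
  obtain ⟨g, b, hg⟩ := hB
  have hAfin : (A S).Finite := (finite_axes_or_coincident S).resolve_right fun hcoin =>
    h (collinearCoincident_of_finset Sᶜ (collinear_image_of_axisCoord_eq hg)
      fun i hi j hj => hcoin i (by simpa using hi) j (by simpa using hj)).symm
  have hBfin : (B S).Finite := (finite_axes_or_coincident Sᶜ).resolve_right fun hcoin =>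
    h (collinearCoincident_of_finset S (collinear_image_of_axisCoord_eq hf)
      fun i hi j hj => hcoin i (Finset.mem_compl.2 hi) j (Finset.mem_compl.2 hj))
  exact hAfin.prod hBfin

/-- The pairs of unit vectors along which the projections of the two families differ by an
inversion or a similarity. -/
def equivalentProjections (p P : Fin n → E3) :
    Set (Metric.sphere (0 : E3) 1 × Metric.sphere (0 : E3) 1) :=
  {LR | DifferByInversion (fun i => orthProj LR.1 (p i)) (fun i => orthProj LR.2 (P i)) ∨
    DifferBySimilarity (fun i => orthProj LR.1 (p i)) (fun i => orthProj LR.2 (P i))}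

theorem mem_of_legSolutions_nonempty {p P : Fin n → E3} (h : ¬CollinearCoincident p P)
    {φ : OrientedAxis × OrientedAxis} (hφ : (legSolutions p P φ).Nonempty) :
    (φ.1.1, φ.2.1) ∈ equivalentProjections p P ∨ φ ∈ butterflyAxes p P := by
  obtain ⟨c, hc, hleg⟩ := hφ
  unfold legForm at hleg
  have hn : Nonempty (Fin n) := by
    by_contra hn
    rw [not_nonempty_iff] at hn
    exact h (collinearCoincident_of_axisCoord_eq (f := φ.1) P fun i => hn.elim i)
  -- For `c 0 = 0` the relation is affine: a similarity, unless a missing linear coefficient makes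
  -- one projected family constant, hence that family collinear.
  by_cases h0 : c 0 = 0
  · simp only [h0, mul_zero, zero_mul, sub_zero] at hleg
    by_cases h1 : c 1 = 0
    · exfalso
      simp only [h1, mul_zero, zero_mul, sub_zero] at hleg
      by_cases h2 : c 2 = 0
      · have h3 := hleg hn.some
        rw [h2] at h3
        apply hc
        ext k
        fin_cases k
        · exact h0
        · exact h1
        · exact h2
        · simpa using h3
      · refine h (collinearCoincident_of_axisCoord_eq (f := φ.2) p fun i j => ?_).symm
        exact mul_left_cancel₀ (mul_ne_zero two_ne_zero h2)
          (by linear_combination hleg j - hleg i)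
    by_cases h2 : c 2 = 0
    · exfalso
      refine h (collinearCoincident_of_axisCoord_eq (f := φ.1) P fun i j => ?_)
      refine mul_left_cancel₀ (mul_ne_zero two_ne_zero h1) ?_
      simp only [h2, mul_zero, zero_mul, sub_zero] at hleg
      linear_combination hleg j - hleg i
    · refine Or.inl (Or.inr (differBySimilarity_of_axisCoord (a := -c 1 / c 2)
        (b := c 3 / (2 * c 2)) (div_ne_zero (neg_ne_zero.2 h1) h2) fun i => ?_))
      field_simp
      linear_combination -hleg i
  -- Completing the product gives `(ζ - a)(ω - b) = k`: an inversion for `k ≠ 0`, a butterfly pair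
  -- for `k = 0`.
  · have hfac : ∀ i, (axisCoord φ.1 (p i) - -c 2 / c 0) * (axisCoord φ.2 (P i) - -c 1 / c 0) =
        c 3 / (2 * c 0) + c 1 * c 2 / c 0 ^ 2 := by
      intro i
      field_simp
      linear_combination -c 0 * hleg i
    by_cases hk : c 3 / (2 * c 0) + c 1 * c 2 / c 0 ^ 2 = 0
    · refine Or.inr ⟨-c 2 / c 0, -c 1 / c 0, fun i => ?_⟩
      have := hfac i
      rw [hk] at this
      rcases mul_eq_zero.1 this with h | h
      · exact Or.inl (sub_eq_zero.1 h)
      · exact Or.inr (sub_eq_zero.1 h)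
    · exact Or.inl (Or.inl (differByInversion_of_axisCoord hk hfac))

theorem finite_setOf_legSolutions_nonempty {p P : Fin n → E3} (h : ¬CollinearCoincident p P)
    (ha : (equivalentProjections p P).Finite) :
    {φ | (legSolutions p P φ).Nonempty}.Finite := by
  -- Each pair of unit vectors carries four choices of orientations.
  have h1 : ((fun a : (Metric.sphere (0 : E3) 1 × Metric.sphere (0 : E3) 1) × Bool × Bool =>
      (((a.1.1, a.2.1), (a.1.2, a.2.2)) : OrientedAxis × OrientedAxis)) ''
      (equivalentProjections p P ×ˢ Set.univ)).Finite := (ha.prod Set.finite_univ).image _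
  refine (h1.union (finite_butterflyAxes h)).subset fun φ hφ => ?_
  rcases mem_of_legSolutions_nonempty h hφ with h2 | h2
  · exact Or.inl ⟨((φ.1.1, φ.2.1), (φ.1.2, φ.2.2)), ⟨h2, trivial⟩, rfl⟩
  · exact Or.inr h2

end Splittings

/-! ### Conclusion: finitely many points at infinity. -/

instance : Finite Coord :=
  Finite.of_injective
    (fun | m i j => Sum.inl (i, j) | x i => Sum.inr (Sum.inl i)
         | y i => Sum.inr (Sum.inr (Sum.inl i)) | r => Sum.inr (Sum.inr (Sum.inr ())) :
      Coord → (Fin 3 × Fin 3) ⊕ Fin 3 ⊕ Fin 3 ⊕ Unit)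
    fun a b h => by cases a <;> cases b <;> simp_all

theorem NPod.mobility_le_one {n : ℕ} (T : NPod n)
    (ha : (equivalentProjections T.p T.P).Finite) (hb : ¬CollinearCoincident T.p T.P)
    (hc : ¬OnParallelLines T.p T.P) : T.mobility ≤ 1 := by
  have hfin := finite_setOf_legSolutions_nonempty hb ha
  have : Finite {φ | (legSolutions T.p T.P φ).Nonempty} := hfin
  choose c hc' using fun φ : {φ | (legSolutions T.p T.P φ).Nonempty} => φ.2
  refine ringKrullDim_quotient_le_one_of_finite
    (fun φ : {φ | (legSolutions T.p T.P φ).Nonempty} => bond φ (c φ))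
    (fun φ => bond_ne_zero φ (hc' φ).1) fun z hz hz0 => ?_
  have hbond := T.isBond_of_mem_pointsAtInfinity hz
  obtain ⟨φ, d, rfl⟩ := hbond.exists_coefficients
  have hd : d ∈ legSolutions T.p T.P φ := by
    refine ⟨fun h0 => hz0 ?_, hbond.legForm_eq_zero⟩
    rw [h0, ← zero_smul ℂ (0 : Fin 4 → ℂ), bond_smul, zero_smul]
  refine ⟨⟨φ, d, hd⟩, ?_⟩
  -- A point at infinity off the chosen line over `φ` would give a second, independent form for the
  -- same axes.
  by_contra! hne
  have hprop : ∀ t : ℂ, d ≠ t • c ⟨φ, d, hd⟩ := by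
    intro t ht
    apply hne t
    rw [← bond_smul, ← ht]
  exact (split_of_not_proportional (hc' ⟨φ, d, hd⟩) hd hprop).elim hb hc

end

theorem mainTheorem2 {n : ℕ} (T : NPod n) (hT : 2 ≤ T.mobility) :
    -- (a)
    {LR : Metric.sphere (0 : E3) 1 × Metric.sphere (0 : E3) 1 |
        DifferByInversion (fun i => orthProj LR.1 (T.p i)) (fun i => orthProj LR.2 (T.P i)) ∨
        DifferBySimilarity (fun i => orthProj LR.1 (T.p i))
          (fun i => orthProj LR.2 (T.P i))}.Infinite ∨
    -- (b)
    (∃ (m : ℕ) (τ : Equiv.Perm (Fin n)), m ≤ n ∧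
      ((Collinear ℝ {q | ∃ i : Fin n, (i : ℕ) < m ∧ q = T.p (τ i)} ∧
          ∀ i j : Fin n, m ≤ (i : ℕ) → m ≤ (j : ℕ) → T.P (τ i) = T.P (τ j)) ∨
        (Collinear ℝ {q | ∃ i : Fin n, (i : ℕ) < m ∧ q = T.P (τ i)} ∧
          ∀ i j : Fin n, m ≤ (i : ℕ) → m ≤ (j : ℕ) → T.p (τ i) = T.p (τ j)))) ∨
    -- (c)
    (∃ (m : ℕ) (τ : Equiv.Perm (Fin n)) (g g' G G' : AffineSubspace ℝ E3),
      1 < m ∧ m + 1 < n ∧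
      IsLine g ∧ IsLine g' ∧ g.Parallel g' ∧ g ≠ g' ∧
      IsLine G ∧ IsLine G' ∧ G.Parallel G' ∧ G ≠ G' ∧
      ∀ i : Fin n,
        ((i : ℕ) < m → T.p (τ i) ∈ g ∧ T.P (τ i) ∈ G) ∧
        (m ≤ (i : ℕ) → T.p (τ i) ∈ g' ∧ T.P (τ i) ∈ G')) := by
  by_contra h
  rw [not_or, not_or] at h
  obtain ⟨ha, hb, hc⟩ := h
  exact absurd (hT.trans (T.mobility_le_one (Set.not_infinite.1 ha) hb hc)) (by decide)
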